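/- Let $\Phi\in\mathbb R^{M\times N}$, let $a^\dagger\in\mathbb R^N$ have exactly $S$ non-zero entries, let $\epsilon\in\mathbb R^M$ and $y=\Phi a^\dagger+\epsilon$. Let $\lambda\ge 0$, $\tau>0$, and let $T_\lambda$ be the soft-thresholding function, applied entrywise: $T_\lambda(v)=0$ if $|v|\le\lambda$ and $T_\lambda(v)=v-\lambda\,\mathrm{sign}(v)$ if $|v|>\lambda$. Let $u:[0,\infty)\to\mathbb R^N$ be a solution of the Locally Competitive Algorithm (LCA) $$\tau\dot u(t)=-u(t)-(\Phi^T\Phi-I)\,a(t)+\Phi^Ty,\qquad a(t)=T_\lambda(u(t)),$$ and let $\Gamma(t)=\{n:\ |u_n(t)|>\lambda\}$ be its active set at time $t$. Let $q\ge 0$ be an integer and suppose that $\Phi$ satisfies the restricted isometry property (RIP) with parameters $(S+q,\bar\delta)$, where $0<\bar\delta<1/3$; that is, $(1-\bar\delta)\|x\|_2^2\le\|\Phi x\|_2^2\le(1+\bar\delta)\|x\|_2^2$ for every $x\in\mathbb R^N$ with at most $S+q$ non-zero entries. Suppose that $$\|u(0)\|_2\le\lambda\sqrt q\qquad\text{and}\qquad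 \lambda\sqrt q\ \ge\ \frac{1+\bar\delta}{1-3\bar\delta}\left(\|a^\dagger\|_2+\sqrt{1-\bar\delta}\,\|\epsilon\|_2\right).$$ Then: 1. the active set never contains more than $q$ nodes: $|\Gamma(t)|\le q$ for all $t\ge0$; 2. the LCA converges exponentially fast with speed $(1-\bar\delta)/\tau$: there are a fixed point $u^*$ of the LCA, whose output $a^*=T_\lambda(u^*)$ minimizes $\frac12\|y-\Phi a\|_2^2+\lambda\|a\|_1$ over $a\in\mathbb R^N$, and a constant $K>0$ such that $\|u(t)-u^*\|_2\le K e^{-(1-\bar\delta)t/\tau}$ for all $t\ge0$. -/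

import Mathlib

namespace LCA

noncomputable section

/-- The matrix-vector product, between Euclidean spaces (so that `‖·‖` is the `ℓ₂` norm). -/
def mulE {M N : ℕ} (A : Matrix (Fin M) (Fin N) ℝ) (x : EuclideanSpace ℝ (Fin N)) :
    EuclideanSpace ℝ (Fin M) :=
  WithLp.toLp 2 (A.mulVec x.ofLp)

/-- The `ℓ₀` pseudo-norm: the number of non-zero entries. -/
def l0 {N : ℕ} (x : EuclideanSpace ℝ (Fin N)) : ℕ :=
  (Finset.univ.filter fun n => x n ≠ 0).card

/-- `Φ` satisfies the restricted isometry property with parameters `(k, δ)`. -/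
def RIP {M N : ℕ} (Φ : Matrix (Fin M) (Fin N) ℝ) (k : ℕ) (δ : ℝ) : Prop :=
  0 < δ ∧ δ < 1 ∧ ∀ x : EuclideanSpace ℝ (Fin N), l0 x ≤ k →
    (1 - δ) * ‖x‖ ^ 2 ≤ ‖mulE Φ x‖ ^ 2 ∧ ‖mulE Φ x‖ ^ 2 ≤ (1 + δ) * ‖x‖ ^ 2

/-- The scalar soft-thresholding function `T_λ`. -/
def softThreshold (lam v : ℝ) : ℝ :=
  if |v| ≤ lam then 0 else v - lam * Real.sign v

/-- Soft-thresholding applied to every entry: the output `a` of the internal state `u`. -/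
def output {N : ℕ} (lam : ℝ) (u : EuclideanSpace ℝ (Fin N)) : EuclideanSpace ℝ (Fin N) :=
  WithLp.toLp 2 fun n => softThreshold lam (u n)

/-- The set of active nodes of the internal state `u`. -/
def activeSet {N : ℕ} (lam : ℝ) (u : EuclideanSpace ℝ (Fin N)) : Finset (Fin N) :=
  Finset.univ.filter fun n => lam < |u n|

/-- The right-hand side `-u - (ΦᵀΦ - I) a + Φᵀ y`, with `a = T_λ(u)`, of the LCA equation. -/
def field {M N : ℕ} (Φ : Matrix (Fin M) (Fin N) ℝ) (y : EuclideanSpace ℝ (Fin M)) (lam : ℝ)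
    (u : EuclideanSpace ℝ (Fin N)) : EuclideanSpace ℝ (Fin N) :=
  -u - mulE (Φ.transpose * Φ - 1) (output lam u) + mulE Φ.transpose y

/-- `u` solves `τ u'(t) = -u(t) - (ΦᵀΦ - I) a(t) + Φᵀ y`, `a(t) = T_λ(u(t))`, on `[0, ∞)`
(with the one-sided derivative at `t = 0`). -/
def IsTrajectory {M N : ℕ} (Φ : Matrix (Fin M) (Fin N) ℝ) (y : EuclideanSpace ℝ (Fin M))
    (lam τ : ℝ) (u : ℝ → EuclideanSpace ℝ (Fin N)) : Prop :=
  ∀ t : ℝ, 0 ≤ t → ∃ u' : EuclideanSpace ℝ (Fin N),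
    HasDerivWithinAt u u' (Set.Ici 0) t ∧ τ • u' = field Φ y lam (u t)

/-- The objective `½ ‖y - Φ a‖₂² + λ ‖a‖₁`. -/
def objective {M N : ℕ} (Φ : Matrix (Fin M) (Fin N) ℝ) (y : EuclideanSpace ℝ (Fin M)) (lam : ℝ)
    (a : EuclideanSpace ℝ (Fin N)) : ℝ :=
  1 / 2 * ‖y - mulE Φ a‖ ^ 2 + lam * ∑ n, |a n|

end

end LCA

namespace LCA

/-! Sparsity. The invariant region consists of the states whose restriction to every set of at most
`q` coordinates has norm at most `λ√q`; there fewer than `q` nodes are active. If a set `s` attains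
the bound, it is maximal and so contains all active nodes. With `x` the restriction of `u` to `s`,
the output `a` lives on `s` and `‖a‖ ≤ ‖x‖`, so the polarized RIP gives `⟨x, a⟩ - ⟨Φx, Φa⟩ ≤ δ‖x‖²`.
Hence the field pushes `x` inwards once `(1-δ)‖x‖` exceeds `(1+δ)‖a†‖ + √(1+δ)‖ε‖`, which the
hypothesis on `λ√q` ensures (`inner_restrict_field_le`, `threshold_bound`,
`norm_sq_restrict_le_of_inward`).

Convergence. Relative to a fixed point, the Bregman divergence of `T_λ²/2` never increases. On the
compact closure of the orbit the dissipation must vanish somewhere, and there the output is that of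
some fixed point `w`. The divergence from `w` then tends to zero, so outputs and finally states
converge (`IsTrajectory.exists_tendsto`).

Rate. Fewer than `q` coordinates of `w` reach the threshold, since the field would otherwise point
strictly inwards at `w`, where it vanishes. Eventually the output error lives on these coordinates,
where the polarized RIP yields decay at rate `(1-δ)/τ`; the other coordinates relax at the faster
rate `1/τ` under a forcing that decays at this rate (`IsTrajectory.exists_exp_bound`). -/

/-! ### Scalar soft-thresholding -/

theorem softThreshold_eq {lam : ℝ} (hlam : 0 ≤ lam) (v : ℝ) :
    softThreshold lam v = max (v - lam) 0 + min (v + lam) 0 := by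
  unfold softThreshold
  split_ifs with h
  · rw [abs_le] at h
    rw [max_eq_right (by linarith), min_eq_right (by linarith), add_zero]
  · rcases lt_abs.1 (not_le.1 h) with h | h
    · rw [Real.sign_of_pos (by linarith), max_eq_left (by linarith), min_eq_right (by linarith)]
      ring
    · rw [Real.sign_of_neg (by linarith), max_eq_right (by linarith), min_eq_left (by linarith)]
      ring

theorem continuous_softThreshold {lam : ℝ} (hlam : 0 ≤ lam) : Continuous (softThreshold lam) := by
  have : softThreshold lam = fun v => max (v - lam) 0 + min (v + lam) 0 :=
    funext (softThreshold_eq hlam)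
  rw [this]
  fun_prop

/-- The three branches of the soft-thresholding function. -/
theorem softThreshold_cases {lam : ℝ} (hlam : 0 ≤ lam) (v : ℝ) :
    (lam < v ∧ softThreshold lam v = v - lam) ∨ (v < -lam ∧ softThreshold lam v = v + lam) ∨
      (-lam ≤ v ∧ v ≤ lam ∧ softThreshold lam v = 0) := by
  rw [softThreshold_eq hlam]
  rcases lt_or_ge lam v with h | h
  · left
    rw [max_eq_left (by linarith), min_eq_right (by linarith)]
    exact ⟨h, by ring⟩
  · rcases lt_or_ge v (-lam) with h' | h'
    · right; left
      rw [max_eq_right (by linarith), min_eq_left (by linarith)]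
      exact ⟨h', by ring⟩
    · right; right
      rw [max_eq_right (by linarith), min_eq_right (by linarith)]
      exact ⟨h', h, by ring⟩

theorem softThreshold_of_abs_le {lam v : ℝ} (h : |v| ≤ lam) : softThreshold lam v = 0 :=
  if_pos h

theorem abs_softThreshold_sub_le {lam : ℝ} (hlam : 0 ≤ lam) (v w : ℝ) :
    |softThreshold lam v - softThreshold lam w| ≤ |v - w| := by
  rcases softThreshold_cases hlam v with ⟨h1, h2⟩ | ⟨h1, h2⟩ | ⟨h1, h1', h2⟩ <;>
  rcases softThreshold_cases hlam w with ⟨h3, h4⟩ | ⟨h3, h4⟩ | ⟨h3, h3', h4⟩ <;>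
  rw [h2, h4, abs_le] <;>
  constructor <;> cases abs_cases (v - w) <;> linarith

theorem abs_softThreshold_le {lam : ℝ} (hlam : 0 ≤ lam) (v : ℝ) :
    |softThreshold lam v| ≤ |v| := by
  have h := abs_softThreshold_sub_le hlam v 0
  rwa [softThreshold_of_abs_le (v := 0) (by simpa using hlam), sub_zero, sub_zero] at h

/-! ### The scalar Bregman divergence -/

/-- The Bregman divergence of the primitive `v ↦ T_λ(v)² / 2` of soft-thresholding. -/
noncomputable def bregman (lam v w : ℝ) : ℝ :=
  softThreshold lam v ^ 2 / 2 - softThreshold lam w ^ 2 / 2 - softThreshold lam w * (v - w)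

/-- `T_λ` is the 1-Lipschitz derivative of the convex function `T_λ²/2`; this bound is its
cocoercivity, and `bregman_le_half_sq` is its smoothness. -/
theorem half_sq_le_bregman {lam : ℝ} (hlam : 0 ≤ lam) (v w : ℝ) :
    (softThreshold lam v - softThreshold lam w) ^ 2 / 2 ≤ bregman lam v w := by
  unfold bregman
  rcases softThreshold_cases hlam v with ⟨h1, h2⟩ | ⟨h1, h2⟩ | ⟨h1, h1', h2⟩ <;>
  rcases softThreshold_cases hlam w with ⟨h3, h4⟩ | ⟨h3, h4⟩ | ⟨h3, h3', h4⟩ <;>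
  rw [h2, h4] <;> nlinarith

theorem bregman_le_half_sq {lam : ℝ} (hlam : 0 ≤ lam) (v w : ℝ) :
    bregman lam v w ≤ (v - w) ^ 2 / 2 := by
  unfold bregman
  rcases softThreshold_cases hlam v with ⟨h1, h2⟩ | ⟨h1, h2⟩ | ⟨h1, h1', h2⟩ <;>
  rcases softThreshold_cases hlam w with ⟨h3, h4⟩ | ⟨h3, h4⟩ | ⟨h3, h3', h4⟩ <;>
  rw [h2, h4] <;> nlinarith

/-- Outside the dead zone equal outputs force `v = w`; inside it every term vanishes. Convergence of
outputs can therefore be tested by the divergence alone. -/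
theorem bregman_eq_zero {lam : ℝ} (hlam : 0 ≤ lam) {v w : ℝ}
    (h : softThreshold lam v = softThreshold lam w) : bregman lam v w = 0 := by
  unfold bregman
  rw [h]
  rcases softThreshold_cases hlam v with ⟨h1, h2⟩ | ⟨h1, h2⟩ | ⟨h1, h1', h2⟩ <;>
  rcases softThreshold_cases hlam w with ⟨h3, h4⟩ | ⟨h3, h4⟩ | ⟨h3, h3', h4⟩ <;>
  rw [h2, h4] at h <;> rw [h4] <;> try linarith
  · rw [show v = w by linarith]; ring
  · rw [show v = w by linarith]; ring

/-- Firm nonexpansiveness of the proximal map `T_λ`; it makes the dissipation nonnegative. -/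
theorem softThreshold_mul_residual_nonneg {lam : ℝ} (hlam : 0 ≤ lam) (v w : ℝ) :
    0 ≤ (softThreshold lam v - softThreshold lam w) *
      ((v - w) - (softThreshold lam v - softThreshold lam w)) := by
  rcases softThreshold_cases hlam v with ⟨h1, h2⟩ | ⟨h1, h2⟩ | ⟨h1, h1', h2⟩ <;>
  rcases softThreshold_cases hlam w with ⟨h3, h4⟩ | ⟨h3, h4⟩ | ⟨h3, h3', h4⟩ <;>
  rw [h2, h4] <;> nlinarith

/-- `v - T_λ(v)` is a subgradient of `λ |·|` at `T_λ(v)`. -/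
theorem subgradient_softThreshold {lam : ℝ} (hlam : 0 ≤ lam) (v s : ℝ) :
    (v - softThreshold lam v) * (s - softThreshold lam v) ≤
      lam * |s| - lam * |softThreshold lam v| := by
  rcases softThreshold_cases hlam v with ⟨h1, h2⟩ | ⟨h1, h2⟩ | ⟨h1, h1', h2⟩
  · rw [h2, abs_of_pos (by linarith : 0 < v - lam)]
    nlinarith [le_abs_self s]
  · rw [h2, abs_of_neg (by linarith : v + lam < 0)]
    nlinarith [neg_abs_le s]
  · rw [h2, abs_zero]
    nlinarith [neg_abs_le s, le_abs_self s, abs_nonneg s]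

/-- A subgradient inequality for `λ |·|` characterizes the values of soft-thresholding. -/
theorem softThreshold_add_eq {lam : ℝ} (hlam : 0 ≤ lam) {a r : ℝ}
    (h : ∀ s : ℝ, r * (s - a) ≤ lam * |s| - lam * |a|) : softThreshold lam (a + r) = a := by
  have h1 := h (softThreshold lam (a + r))
  have h2 := subgradient_softThreshold hlam (a + r) a
  -- The sum of the two subgradient inequalities is `(T_λ(a + r) - a)² ≤ 0`.
  nlinarith [sq_nonneg (softThreshold lam (a + r) - a)]

/-- By the three-point identity, `bregman x w` is `bregman x v` plus an affine function of `x`;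
since `bregman x v = O((x - v)²)`, no case distinction at the kinks `±λ` is needed. -/
theorem hasDerivAt_bregman {lam : ℝ} (hlam : 0 ≤ lam) (v w : ℝ) :
    HasDerivAt (fun x => bregman lam x w) (softThreshold lam v - softThreshold lam w) v := by
  have h0 : HasDerivAt (fun x => bregman lam x v) 0 v := by
    have hO : (fun x => bregman lam x v) =O[nhds v] fun x => ‖x - v‖ ^ 2 := by
      refine Asymptotics.IsBigO.of_bound 1 (Filter.Eventually.of_forall fun x => ?_)
      have h1 := half_sq_le_bregman hlam x v
      have h2 := bregman_le_half_sq hlam x v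
      rw [Real.norm_eq_abs, abs_of_nonneg (le_trans (by positivity) h1), Real.norm_eq_abs,
        Real.norm_eq_abs, sq_abs, abs_of_nonneg (sq_nonneg _)]
      nlinarith [sq_nonneg (x - v)]
    simpa using (hO.hasFDerivAt (by norm_num)).hasDerivAt
  have h1 : HasDerivAt (fun x => bregman lam x v + bregman lam v w +
      (softThreshold lam v - softThreshold lam w) * (x - v))
      (0 + (softThreshold lam v - softThreshold lam w) * 1) v :=
    (h0.add_const _).add (((hasDerivAt_id v).sub_const v).const_mul _)
  convert h1 using 1
  · funext x
    unfold bregman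
    ring
  · ring

/-! ### Matrix-vector products, the field and the output -/

theorem mulE_add {M N : ℕ} (A : Matrix (Fin M) (Fin N) ℝ) (x z : EuclideanSpace ℝ (Fin N)) :
    mulE A (x + z) = mulE A x + mulE A z := by
  ext i
  simp [mulE, Matrix.mulVec_add]

theorem mulE_smul {M N : ℕ} (A : Matrix (Fin M) (Fin N) ℝ) (c : ℝ)
    (x : EuclideanSpace ℝ (Fin N)) : mulE A (c • x) = c • mulE A x := by
  ext i
  simp [mulE, Matrix.mulVec_smul]

theorem mulE_sub {M N : ℕ} (A : Matrix (Fin M) (Fin N) ℝ) (x z : EuclideanSpace ℝ (Fin N)) :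
    mulE A (x - z) = mulE A x - mulE A z := by
  ext i
  simp [mulE, Matrix.mulVec_sub]

theorem mulE_zero {M N : ℕ} (A : Matrix (Fin M) (Fin N) ℝ) : mulE A 0 = 0 := by
  ext i
  simp [mulE]

theorem continuous_mulE {M N : ℕ} (A : Matrix (Fin M) (Fin N) ℝ) : Continuous (mulE A) :=
  LinearMap.continuous_of_finiteDimensional
    ({ toFun := mulE A, map_add' := mulE_add A, map_smul' := mulE_smul A } :
      EuclideanSpace ℝ (Fin N) →ₗ[ℝ] EuclideanSpace ℝ (Fin M))

theorem exists_norm_mulE_le {M N : ℕ} (A : Matrix (Fin M) (Fin N) ℝ) :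
    ∃ C : ℝ, 0 < C ∧ ∀ x, ‖mulE A x‖ ≤ C * ‖x‖ := by
  let f : EuclideanSpace ℝ (Fin N) →L[ℝ] EuclideanSpace ℝ (Fin M) :=
    LinearMap.toContinuousLinearMap
      { toFun := mulE A, map_add' := mulE_add A, map_smul' := mulE_smul A }
  exact f.bound

theorem inner_mulE_transpose {M N : ℕ} (A : Matrix (Fin M) (Fin N) ℝ)
    (x : EuclideanSpace ℝ (Fin N)) (z : EuclideanSpace ℝ (Fin M)) :
    inner ℝ x (mulE A.transpose z) = inner ℝ (mulE A x) z := by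
  simp only [EuclideanSpace.inner_eq_star_dotProduct, mulE, star_trivial]
  rw [Matrix.mulVec_transpose, ← Matrix.dotProduct_mulVec]

theorem mulE_gram_sub_one {M N : ℕ} (A : Matrix (Fin M) (Fin N) ℝ)
    (x : EuclideanSpace ℝ (Fin N)) :
    mulE (A.transpose * A - 1) x = mulE A.transpose (mulE A x) - x := by
  ext i
  simp [mulE, Matrix.sub_mulVec, Matrix.mulVec_mulVec]

theorem field_eq {M N : ℕ} (Φ : Matrix (Fin M) (Fin N) ℝ) (y : EuclideanSpace ℝ (Fin M))
    (lam : ℝ) (u : EuclideanSpace ℝ (Fin N)) :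
    field Φ y lam u = -u + output lam u + mulE Φ.transpose (y - mulE Φ (output lam u)) := by
  rw [field, mulE_gram_sub_one, mulE_sub]
  abel

/-- This is the optimality condition of the objective: `u - a` is a subgradient of `λ‖·‖₁` at `a`.
-/
theorem field_eq_zero_iff {M N : ℕ} {Φ : Matrix (Fin M) (Fin N) ℝ}
    {y : EuclideanSpace ℝ (Fin M)} {lam : ℝ} {u : EuclideanSpace ℝ (Fin N)} :
    field Φ y lam u = 0 ↔
      u - output lam u = mulE Φ.transpose (y - mulE Φ (output lam u)) := by
  rw [field_eq, ← sub_eq_zero (a := u - output lam u), ← neg_eq_zero (a := u - _ - _)]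
  rw [show -(u - output lam u - mulE Φ.transpose (y - mulE Φ (output lam u))) =
    -u + output lam u + mulE Φ.transpose (y - mulE Φ (output lam u)) by abel]

theorem output_apply {N : ℕ} (lam : ℝ) (u : EuclideanSpace ℝ (Fin N)) (n : Fin N) :
    output lam u n = softThreshold lam (u n) := rfl

theorem continuous_output {N : ℕ} {lam : ℝ} (hlam : 0 ≤ lam) :
    Continuous (output (N := N) lam) := by
  refine (PiLp.continuous_toLp 2 _).comp (continuous_pi fun n => ?_)
  exact (continuous_softThreshold hlam).comp (PiLp.continuous_apply 2 _ n)

/-! ### Restrictions to coordinates and the isometry property -/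

/-- The restriction of a vector to a set of coordinates. -/
noncomputable def restrict {N : ℕ} (s : Finset (Fin N)) (x : EuclideanSpace ℝ (Fin N)) :
    EuclideanSpace ℝ (Fin N) :=
  WithLp.toLp 2 fun n => if n ∈ s then x n else 0

theorem restrict_apply {N : ℕ} (s : Finset (Fin N)) (x : EuclideanSpace ℝ (Fin N)) (n : Fin N) :
    restrict s x n = if n ∈ s then x n else 0 := rfl

theorem norm_sq_eq_sum {N : ℕ} (x : EuclideanSpace ℝ (Fin N)) : ‖x‖ ^ 2 = ∑ n, x n ^ 2 := by
  simp [EuclideanSpace.norm_sq_eq]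

theorem inner_eq_sum {N : ℕ} (x z : EuclideanSpace ℝ (Fin N)) :
    inner ℝ x z = ∑ n, x n * z n := by
  simp [PiLp.inner_apply, mul_comm]

theorem norm_sq_restrict {N : ℕ} (s : Finset (Fin N)) (x : EuclideanSpace ℝ (Fin N)) :
    ‖restrict s x‖ ^ 2 = ∑ n ∈ s, x n ^ 2 := by
  rw [norm_sq_eq_sum]
  simp [restrict_apply, ite_pow]

theorem inner_restrict {N : ℕ} (s : Finset (Fin N)) (x z : EuclideanSpace ℝ (Fin N)) :
    inner ℝ (restrict s x) z = ∑ n ∈ s, x n * z n := by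
  rw [inner_eq_sum]
  simp [restrict_apply]

theorem l0_le_card {N : ℕ} {s : Finset (Fin N)} {x : EuclideanSpace ℝ (Fin N)}
    (h : ∀ n, n ∉ s → x n = 0) : l0 x ≤ s.card := by
  refine Finset.card_le_card fun n hn => ?_
  by_contra hns
  exact (Finset.mem_filter.1 hn).2 (h n hns)

theorem mem_activeSet {N : ℕ} {lam : ℝ} {u : EuclideanSpace ℝ (Fin N)} {n : Fin N} :
    n ∈ activeSet lam u ↔ lam < |u n| := by
  simp [activeSet]

/-- The polarized form of the restricted isometry property. -/
theorem RIP.inner_sub_inner_le {M N k : ℕ} {Φ : Matrix (Fin M) (Fin N) ℝ} {δ : ℝ}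
    (h : RIP Φ k δ) {s : Finset (Fin N)} (hs : s.card ≤ k) {x z : EuclideanSpace ℝ (Fin N)}
    (hx : ∀ n, n ∉ s → x n = 0) (hz : ∀ n, n ∉ s → z n = 0) :
    inner ℝ x z - inner ℝ (mulE Φ x) (mulE Φ z) ≤ δ / 2 * (‖x‖ ^ 2 + ‖z‖ ^ 2) := by
  have hp := (h.2.2 (x + z) ((l0_le_card fun n hn => by simp [hx n hn, hz n hn]).trans hs)).1
  have hm := (h.2.2 (x - z) ((l0_le_card fun n hn => by simp [hx n hn, hz n hn]).trans hs)).2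
  rw [mulE_add, norm_add_sq_real, norm_add_sq_real] at hp
  rw [mulE_sub, norm_sub_sq_real, norm_sub_sq_real] at hm
  -- The lower bound at `x + z` minus the upper bound at `x - z`, divided by 4.
  nlinarith

theorem RIP.norm_mulE_le {M N k : ℕ} {Φ : Matrix (Fin M) (Fin N) ℝ} {δ : ℝ}
    (h : RIP Φ k δ) {x : EuclideanSpace ℝ (Fin N)} (hx : l0 x ≤ k) :
    ‖mulE Φ x‖ ≤ Real.sqrt (1 + δ) * ‖x‖ := by
  have h0 : 0 ≤ 1 + δ := by linarith [h.1]
  refine le_of_sq_le_sq ?_ (by positivity)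
  rw [mul_pow, Real.sq_sqrt h0]
  exact (h.2.2 x hx).2

/-- The field pushes the restriction of the state to a small set containing all active nodes
inwards, as soon as this restriction is large. -/
theorem inner_restrict_field_le {M N S q : ℕ} {Φ : Matrix (Fin M) (Fin N) ℝ} {δ : ℝ}
    (hRIP : RIP Φ (S + q) δ) {aDag : EuclideanSpace ℝ (Fin N)} (hS : l0 aDag = S)
    (ε : EuclideanSpace ℝ (Fin M)) {lam : ℝ} (hlam : 0 ≤ lam)
    {u : EuclideanSpace ℝ (Fin N)} {s : Finset (Fin N)} (hs : s.card ≤ q)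
    (hu : activeSet lam u ⊆ s) :
    inner ℝ (restrict s u) (field Φ (mulE Φ aDag + ε) lam u) ≤
      -((1 - δ) * ‖restrict s u‖ ^ 2) +
        ((1 + δ) * ‖aDag‖ + Real.sqrt (1 + δ) * ‖ε‖) * ‖restrict s u‖ := by
  set x := restrict s u with hx
  set a := output lam u with ha
  have hδ := hRIP.1
  have hxs : ∀ n, n ∉ s → x n = 0 := fun n hn => by simp [hx, restrict_apply, hn]
  have has : ∀ n, n ∉ s → a n = 0 := fun n hn => by
    rw [ha, output_apply]
    refine softThreshold_of_abs_le (not_lt.1 fun h => hn (hu (mem_activeSet.2 h)))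
  have hax : ‖a‖ ^ 2 ≤ ‖x‖ ^ 2 := by
    rw [norm_sq_eq_sum, norm_sq_eq_sum]
    refine Finset.sum_le_sum fun n _ => ?_
    by_cases hn : n ∈ s
    · rw [hx, restrict_apply, if_pos hn, ha, output_apply]
      exact sq_le_sq.2 (abs_softThreshold_le hlam _)
    · rw [has n hn, zero_pow two_ne_zero]; exact sq_nonneg _
  -- Both vectors live on `s`, and `hax` turns the error into `δ‖x‖²`. The vector `a†` enters only
  -- through Cauchy-Schwarz, so the union of its support with `s` plays no role.
  have hB := hRIP.inner_sub_inner_le (hs.trans (Nat.le_add_left _ _)) hxs has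
  have hxu : inner ℝ x u = ‖x‖ ^ 2 := by
    rw [hx, inner_restrict, norm_sq_restrict]
    exact Finset.sum_congr rfl fun n _ => by ring
  have hΦx := hRIP.norm_mulE_le (x := x)
    ((l0_le_card hxs).trans (hs.trans (Nat.le_add_left _ _)))
  have hΦa := hRIP.norm_mulE_le (x := aDag) (hS.le.trans (Nat.le_add_right _ _))
  have h1 : inner ℝ (mulE Φ x) (mulE Φ aDag) ≤ (1 + δ) * ‖aDag‖ * ‖x‖ := by
    refine (real_inner_le_norm _ _).trans
      ((mul_le_mul hΦx hΦa (norm_nonneg _) (by positivity)).trans_eq ?_)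
    calc Real.sqrt (1 + δ) * ‖x‖ * (Real.sqrt (1 + δ) * ‖aDag‖)
        = Real.sqrt (1 + δ) ^ 2 * ‖aDag‖ * ‖x‖ := by ring
      _ = _ := by rw [Real.sq_sqrt (by linarith)]
  have h2 : inner ℝ (mulE Φ x) ε ≤ Real.sqrt (1 + δ) * ‖ε‖ * ‖x‖ := by
    refine (real_inner_le_norm _ _).trans
      ((mul_le_mul_of_nonneg_right hΦx (norm_nonneg _)).trans_eq (by ring))
  rw [field_eq, inner_add_right, inner_add_right, inner_neg_right, hxu, inner_mulE_transpose,
    inner_sub_right, inner_add_right]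
  nlinarith

theorem threshold_bound {δ A E c : ℝ} (h0 : 0 < δ) (hδ : δ < 1 / 3) (hA : 0 ≤ A) (hE : 0 ≤ E)
    (hc : 0 < c) (h : (1 + δ) / (1 - 3 * δ) * (A + Real.sqrt (1 - δ) * E) ≤ c) :
    (1 + δ) * A + Real.sqrt (1 + δ) * E < (1 - δ) * c := by
  have h3 : 0 < 1 - 3 * δ := by linarith
  rw [div_mul_eq_mul_div, div_le_iff₀ h3] at h
  set p := Real.sqrt (1 + δ) with hp
  set m := Real.sqrt (1 - δ) with hm
  have hp2 : p ^ 2 = 1 + δ := Real.sq_sqrt (by linarith)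
  have hm2 : m ^ 2 = 1 - δ := Real.sq_sqrt (by linarith)
  have hp0 : 0 < p := Real.sqrt_pos.2 (by linarith)
  have hm0 : 0 < m := Real.sqrt_pos.2 (by linarith)
  have hmp : m ≤ p := Real.sqrt_le_sqrt (by linarith)
  -- That is, `p m² ≤ p² m`, or `m ≤ p`.
  have hpm : p * (1 - δ) ≤ (1 + δ) * m := by
    rw [← hp2, ← hm2]
    nlinarith [mul_nonneg (mul_pos hp0 hm0).le (sub_nonneg.2 hmp)]
  have hE1 : p * E * (1 - δ) ≤ (1 + δ) * m * E := by nlinarith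
  have hkey : ((1 + δ) * A + p * E) * (1 - δ) ≤ c * (1 - 3 * δ) := by
    nlinarith [mul_nonneg (mul_nonneg (by linarith : 0 ≤ 1 + δ) hA) h0.le]
  -- Strictness comes from `(1-δ)² - (1-3δ) = δ + δ² > 0`.
  have hlt : c * (1 - 3 * δ) < c * (1 - δ) * (1 - δ) := by nlinarith [sq_nonneg δ]
  nlinarith

open Set Filter Topology

/-! ### Comparison estimates and derivatives along trajectories -/

/-- A real function whose right derivative is at most `-m` decreases at rate at least `m`. -/
theorem le_sub_mul_of_right_deriv_le {f f' : ℝ → ℝ} {s t m : ℝ} (hst : s ≤ t)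
    (hf : ContinuousOn f (Ici s)) (hf' : ∀ x, s ≤ x → HasDerivWithinAt f (f' x) (Ici x) x)
    (hm : ∀ x, s ≤ x → f' x ≤ -m) : f t ≤ f s - m * (t - s) := by
  have hB : ∀ x, HasDerivAt (fun z => f s - m * (z - s)) (-m) x := fun x => by
    simpa using (((hasDerivAt_id x).sub_const s).const_mul m).const_sub (f s)
  exact image_le_of_deriv_right_le_deriv_boundary (b := t) (hf.mono Icc_subset_Ici_self)
    (fun x hx => hf' x hx.1) (by simp)
    (fun x _ => (hB x).continuousAt.continuousWithinAt) (fun x _ => (hB x).hasDerivWithinAt)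
    (fun x hx => hm x hx.1) ⟨hst, le_rfl⟩

/-- Solutions of `τ w' = -w + g` decay as fast as the forcing term `g`, if this decays more slowly
than `exp (-t / τ)`. -/
theorem norm_le_of_relaxation {E : Type*} [NormedAddCommGroup E] [NormedSpace ℝ E]
    {w w' g : ℝ → E} {τ β η s : ℝ} (hτ : 0 < τ) (hβ : β < 1) (hη : 0 ≤ η)
    (hw : ContinuousOn w (Ici s)) (hw' : ∀ t, s ≤ t → HasDerivWithinAt w (w' t) (Ici t) t)
    (heq : ∀ t, s ≤ t → τ • w' t = -w t + g t)
    (hg : ∀ t, s ≤ t → ‖g t‖ ≤ η * Real.exp (-(β * t / τ))) {t : ℝ} (ht : s ≤ t) :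
    ‖w t‖ ≤ Real.exp (-((t - s) / τ)) * ‖w s‖ + η / (1 - β) * Real.exp (-(β * t / τ)) := by
  have hβ' : 0 < 1 - β := sub_pos.2 hβ
  have hexp : ∀ x, HasDerivAt (fun z => Real.exp ((z - s) / τ)) (Real.exp ((x - s) / τ) / τ) x :=
    fun x => by
      simpa [div_eq_mul_inv] using (((hasDerivAt_id x).sub_const s).div_const τ).exp
  -- The integrating factor `exp((z-s)/τ)` cancels the term `-w`.
  have hp : ∀ x, s ≤ x → HasDerivWithinAt (fun z => Real.exp ((z - s) / τ) • w z)
      ((Real.exp ((x - s) / τ) / τ) • g x) (Ici x) x := fun x hx => by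
    refine ((hexp x).hasDerivWithinAt.smul (hw' x hx)).congr_deriv ?_
    have : w' x = τ⁻¹ • (-w x + g x) := by rw [← heq x hx, inv_smul_smul₀ hτ.ne']
    rw [this]
    module
  have hB : ∀ x, HasDerivAt
      (fun z => ‖w s‖ + η / (1 - β) * Real.exp (((1 - β) * z - s) / τ))
      (η / τ * Real.exp (((1 - β) * x - s) / τ)) x := fun x => by
    have h1 := ((((((hasDerivAt_id x).const_mul (1 - β)).sub_const s).div_const τ).exp).const_mul
      (η / (1 - β))).const_add ‖w s‖
    refine h1.congr_deriv ?_
    simp only [id]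
    field_simp
  have hmain := image_norm_le_of_norm_deriv_right_le_deriv_boundary (a := s) (b := t)
    (f := fun z => Real.exp ((z - s) / τ) • w z)
    (((Continuous.continuousOn (by fun_prop)).smul hw).mono Icc_subset_Ici_self)
    (fun x hx => hp x hx.1) (by simp; positivity) hB (fun x hx => ?_) ⟨ht, le_rfl⟩
  · simp only [norm_smul, Real.norm_eq_abs, Real.abs_exp] at hmain
    have h2 := mul_le_mul_of_nonneg_left hmain (Real.exp_nonneg (-((t - s) / τ)))
    rw [← mul_assoc, ← Real.exp_add, neg_add_cancel, Real.exp_zero, one_mul, mul_add] at h2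
    refine h2.trans_eq ?_
    congr 1
    rw [mul_left_comm, ← Real.exp_add]
    congr 2
    field_simp
    ring
  · rw [norm_smul, Real.norm_eq_abs, abs_of_pos (by positivity)]
    refine (mul_le_mul_of_nonneg_left (hg x hx.1) (by positivity)).trans_eq ?_
    rw [show Real.exp ((x - s) / τ) / τ * (η * Real.exp (-(β * x / τ))) =
      η / τ * (Real.exp ((x - s) / τ) * Real.exp (-(β * x / τ))) by ring, ← Real.exp_add]
    congr 2
    field_simp
    ring

theorem HasDerivWithinAt.apply_euclidean {N : ℕ} {u : ℝ → EuclideanSpace ℝ (Fin N)}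
    {u' : EuclideanSpace ℝ (Fin N)} {s : Set ℝ} {t : ℝ} (h : HasDerivWithinAt u u' s t)
    (n : Fin N) : HasDerivWithinAt (fun x => u x n) (u' n) s t :=
  ((EuclideanSpace.proj (𝕜 := ℝ) n).hasFDerivAt.comp_hasDerivWithinAt t h :)

theorem IsTrajectory.hasDerivWithinAt {M N : ℕ} {Φ : Matrix (Fin M) (Fin N) ℝ}
    {y : EuclideanSpace ℝ (Fin M)} {lam τ : ℝ} {u : ℝ → EuclideanSpace ℝ (Fin N)}
    (hu : IsTrajectory Φ y lam τ u) (hτ : 0 < τ) {t : ℝ} (ht : 0 ≤ t) :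
    HasDerivWithinAt u (τ⁻¹ • field Φ y lam (u t)) (Ici t) t := by
  obtain ⟨u', h1, h2⟩ := hu t ht
  rw [← h2, inv_smul_smul₀ hτ.ne']
  exact h1.mono (Ici_subset_Ici.2 ht)

theorem IsTrajectory.continuousOn {M N : ℕ} {Φ : Matrix (Fin M) (Fin N) ℝ}
    {y : EuclideanSpace ℝ (Fin M)} {lam τ : ℝ} {u : ℝ → EuclideanSpace ℝ (Fin N)}
    (hu : IsTrajectory Φ y lam τ u) : ContinuousOn u (Ici 0) := fun t ht => by
  obtain ⟨u', h1, -⟩ := hu t ht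
  exact h1.continuousWithinAt

theorem hasDerivWithinAt_norm_sq_restrict {N : ℕ} {u : ℝ → EuclideanSpace ℝ (Fin N)}
    {u' : EuclideanSpace ℝ (Fin N)} {D : Set ℝ} {t : ℝ} (h : HasDerivWithinAt u u' D t)
    (s : Finset (Fin N)) :
    HasDerivWithinAt (fun x => ‖restrict s (u x)‖ ^ 2) (2 * inner ℝ (restrict s (u t)) u') D t := by
  simp only [norm_sq_restrict, inner_restrict, Finset.mul_sum]
  refine HasDerivWithinAt.fun_sum fun n _ => ?_
  refine ((HasDerivWithinAt.apply_euclidean h n).pow 2).congr_deriv ?_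
  push_cast
  ring

theorem continuous_restrict {N : ℕ} (s : Finset (Fin N)) : Continuous (restrict s) := by
  refine (PiLp.continuous_toLp 2 _).comp (continuous_pi fun n => ?_)
  by_cases hn : n ∈ s
  · simpa [hn] using PiLp.continuous_apply 2 (fun _ : Fin N => ℝ) n
  · simpa [hn] using continuous_const

/-! ### The invariant region -/

/-- `u` has fewer than `q` coordinates of modulus above `lam` if all its restrictions to at most
`q` coordinates have norm at most `lam * √q`. -/
theorem card_activeSet_lt {N q : ℕ} (hq : 0 < q) {lam : ℝ} (hlam : 0 ≤ lam)
    {u : EuclideanSpace ℝ (Fin N)}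
    (h : ∀ s : Finset (Fin N), s.card ≤ q → ‖restrict s u‖ ^ 2 ≤ lam ^ 2 * q) :
    (activeSet lam u).card < q := by
  by_contra hc
  obtain ⟨s, hs, hcard⟩ := Finset.exists_subset_card_eq (not_lt.1 hc)
  have h1 := h s hcard.le
  rw [norm_sq_restrict] at h1
  have h2 : ∑ _n ∈ s, lam ^ 2 < ∑ n ∈ s, u n ^ 2 := by
    refine Finset.sum_lt_sum_of_nonempty (Finset.card_pos.1 (hcard ▸ hq)) fun n hn => ?_
    rw [← sq_abs (u n)]
    exact pow_lt_pow_left₀ (mem_activeSet.1 (hs hn)) hlam two_ne_zero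
  rw [Finset.sum_const, hcard, nsmul_eq_mul] at h2
  linarith

/-- A set of at most `q` coordinates on which `u` is as large as possible contains all active
nodes. -/
theorem activeSet_subset_of_maximal {N q : ℕ} {lam : ℝ} (hlam : 0 ≤ lam)
    {u : EuclideanSpace ℝ (Fin N)} {s : Finset (Fin N)} (hs : s.card ≤ q)
    (hq : (activeSet lam u).card < q)
    (h : ∀ s' : Finset (Fin N), s'.card ≤ q → ‖restrict s' u‖ ^ 2 ≤ ‖restrict s u‖ ^ 2) :
    activeSet lam u ⊆ s := by
  intro m hm
  by_contra hms
  have hm' := mem_activeSet.1 hm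
  have hmpos : lam ^ 2 < u m ^ 2 := by
    rw [← sq_abs (u m)]
    exact pow_lt_pow_left₀ hm' hlam two_ne_zero
  rcases hs.lt_or_eq with hlt | heq
  · have h1 := h (insert m s) ((Finset.card_insert_le _ _).trans hlt)
    rw [norm_sq_restrict, norm_sq_restrict, Finset.sum_insert hms] at h1
    nlinarith [sq_nonneg lam]
  -- With `s` full, exchanging an inactive `k ∈ s` for the active `m` would increase the norm.
  · obtain ⟨k, hks, hk⟩ : ∃ k ∈ s, k ∉ activeSet lam u :=
      Finset.exists_mem_notMem_of_card_lt_card (hq.trans_eq heq.symm)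
    have hmk : m ∉ s.erase k := fun hh => hms (Finset.mem_of_mem_erase hh)
    have h1 := h (insert m (s.erase k)) (by
      rw [Finset.card_insert_of_notMem hmk, Finset.card_erase_of_mem hks, heq]
      have := Finset.card_pos.2 ⟨k, hks⟩
      omega)
    rw [norm_sq_restrict, norm_sq_restrict, Finset.sum_insert hmk,
      ← Finset.add_sum_erase s _ hks] at h1
    have hk' : u k ^ 2 ≤ lam ^ 2 := by
      rw [← sq_abs (u k)]
      exact pow_le_pow_left₀ (abs_nonneg _) (not_lt.1 fun hh => hk (mem_activeSet.2 hh)) 2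
    linarith

/-- The region where all restrictions of the state to at most `q` coordinates have norm at most
`lam * √q` is invariant, if the field points inwards on its boundary. -/
theorem norm_sq_restrict_le_of_inward {M N q : ℕ} (hq : 0 < q) {Φ : Matrix (Fin M) (Fin N) ℝ}
    {y : EuclideanSpace ℝ (Fin M)} {lam τ : ℝ} (hlam : 0 ≤ lam) (hτ : 0 < τ)
    {u : ℝ → EuclideanSpace ℝ (Fin N)} (hu : IsTrajectory Φ y lam τ u)
    (hu0 : ‖u 0‖ ^ 2 ≤ lam ^ 2 * q)
    (hin : ∀ (v : EuclideanSpace ℝ (Fin N)) (s : Finset (Fin N)), s.card ≤ q →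
      activeSet lam v ⊆ s → lam ^ 2 * q ≤ ‖restrict s v‖ ^ 2 →
      inner ℝ (restrict s v) (field Φ y lam v) < 0)
    {t : ℝ} (ht : 0 ≤ t) (s : Finset (Fin N)) (hs : s.card ≤ q) :
    ‖restrict s (u t)‖ ^ 2 ≤ lam ^ 2 * q := by
  set P : Set ℝ := {x | ∀ s : Finset (Fin N), s.card ≤ q →
    ‖restrict s (u x)‖ ^ 2 ≤ lam ^ 2 * q} with hP
  have hcont : ∀ s : Finset (Fin N), ContinuousOn (fun x => ‖restrict s (u x)‖ ^ 2) (Ici 0) :=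
    fun s => (((continuous_restrict s).comp_continuousOn hu.continuousOn).norm).pow 2
  suffices hsub : Icc 0 t ⊆ P from hsub ⟨ht, le_rfl⟩ s hs
  -- Continuous induction. Just after `x`, a strict bound persists by continuity, while an attained
  -- bound has a strictly negative right derivative.
  refine IsClosed.Icc_subset_of_forall_mem_nhdsWithin ?_ ?_ ?_
  · have : P ∩ Icc 0 t = Icc 0 t ∩ ⋂ s : {s : Finset (Fin N) // s.card ≤ q},
        (Icc 0 t ∩ (fun x => ‖restrict s.1 (u x)‖ ^ 2) ⁻¹' Iic (lam ^ 2 * q)) := by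
      ext x
      simp only [hP, mem_inter_iff, mem_ofPred_eq, mem_iInter, mem_preimage, mem_Iic,
        Subtype.forall]
      exact ⟨fun h => ⟨h.2, fun s hs => ⟨h.2, h.1 s hs⟩⟩, fun h => ⟨fun s hs => (h.2 s hs).2, h.1⟩⟩
    rw [this]
    exact isClosed_Icc.inter (isClosed_iInter fun s =>
      ((hcont s).mono Icc_subset_Ici_self).preimage_isClosed_of_isClosed isClosed_Icc isClosed_Iic)
  · intro s _
    refine le_trans ?_ hu0
    rw [norm_sq_restrict, norm_sq_eq_sum]
    exact Finset.sum_le_univ_sum_of_nonneg fun n => sq_nonneg _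
  · rintro x ⟨hx, hx0, -⟩
    have hall : ∀ s : {s : Finset (Fin N) // s.card ≤ q},
        ∀ᶠ z in 𝓝[>] x, ‖restrict s.1 (u z)‖ ^ 2 ≤ lam ^ 2 * q := by
      rintro ⟨s, hs⟩
      rcases (hx s hs).lt_or_eq with hlt | heq
      · have hc : ContinuousWithinAt (fun x => ‖restrict s (u x)‖ ^ 2) (Ioi x) x :=
          (hcont s x hx0).mono fun z hz => hx0.trans (le_of_lt hz)
        exact (hc.eventually_lt_const hlt).mono fun z hz => le_of_lt hz
      · have hsub := activeSet_subset_of_maximal hlam hs (card_activeSet_lt hq hlam hx)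
          fun s' hs' => heq ▸ hx s' hs'
        have hneg : 2 * inner ℝ (restrict s (u x)) (τ⁻¹ • field Φ y lam (u x)) < 0 := by
          rw [inner_smul_right]
          have := mul_neg_of_pos_of_neg (inv_pos.2 hτ) (hin (u x) s hs hsub heq.ge)
          linarith
        have hd := hasDerivWithinAt_norm_sq_restrict (hu.hasDerivWithinAt hτ hx0) s
        filter_upwards [hd.Ioi_of_Ici.limsup_slope_le' (lt_irrefl x) hneg, self_mem_nhdsWithin]
          with z hz hxz
        rw [slope_def_field, div_lt_iff₀ (sub_pos.2 hxz), zero_mul] at hz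
        linarith
    filter_upwards [eventually_all.2 hall] with z hz s hs using hz ⟨s, hs⟩

/-! ### Fixed points and minimizers -/

/-- Fixed points of the dynamics yield minimizers of the objective. -/
theorem isMinOn_output {M N : ℕ} {Φ : Matrix (Fin M) (Fin N) ℝ} {y : EuclideanSpace ℝ (Fin M)}
    {lam : ℝ} (hlam : 0 ≤ lam) {w : EuclideanSpace ℝ (Fin N)} (hw : field Φ y lam w = 0) :
    IsMinOn (objective Φ y lam) univ (output lam w) := by
  intro x _
  set a := output lam w with ha
  have hr := field_eq_zero_iff.1 hw
  have h1 : inner ℝ (x - a) (w - a) ≤ lam * ∑ n, |x n| - lam * ∑ n, |a n| := by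
    rw [inner_eq_sum, Finset.mul_sum, Finset.mul_sum, ← Finset.sum_sub_distrib]
    refine Finset.sum_le_sum fun n _ => ?_
    have := subgradient_softThreshold hlam (w n) (x n)
    rw [← output_apply, ← ha] at this
    simp only [PiLp.sub_apply]
    linarith
  rw [← ha] at hr
  rw [hr, inner_mulE_transpose] at h1
  have h2 : y - mulE Φ x = (y - mulE Φ a) - mulE Φ (x - a) := by rw [mulE_sub]; abel
  change objective Φ y lam a ≤ objective Φ y lam x
  unfold objective
  rw [h2, norm_sub_sq_real (y - mulE Φ a), real_inner_comm]
  nlinarith [sq_nonneg ‖mulE Φ (x - a)‖]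

theorem norm_le_sum_abs {N : ℕ} (x : EuclideanSpace ℝ (Fin N)) : ‖x‖ ≤ ∑ n, |x n| := by
  refine le_of_sq_le_sq ?_ (Finset.sum_nonneg fun n _ => abs_nonneg _)
  rw [norm_sq_eq_sum]
  simp only [← sq_abs (x _)]
  exact Finset.sum_sq_le_sq_sum_of_nonneg fun n _ => abs_nonneg _

theorem exists_forall_objective_le {M N : ℕ} (Φ : Matrix (Fin M) (Fin N) ℝ)
    (y : EuclideanSpace ℝ (Fin M)) {lam : ℝ} (hlam : 0 < lam) :
    ∃ a, ∀ x, objective Φ y lam a ≤ objective Φ y lam x := by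
  refine Continuous.exists_forall_le ?_ ?_
  · unfold objective
    refine (continuous_const.mul ((continuous_const.sub (continuous_mulE Φ)).norm.pow 2)).add
      (continuous_const.mul (continuous_finsetSum _ fun n _ => ?_))
    exact (PiLp.continuous_apply 2 (fun _ : Fin N => ℝ) n).abs
  · refine tendsto_atTop_mono (fun x => ?_) ((tendsto_norm_cocompact_atTop).const_mul_atTop hlam)
    have := mul_le_mul_of_nonneg_left (norm_le_sum_abs x) hlam.le
    unfold objective
    nlinarith [sq_nonneg ‖y - mulE Φ x‖]

theorem le_of_forall_mul_le_mul_add_sq {p r k : ℝ}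
    (h : ∀ θ : ℝ, 0 < θ → θ ≤ 1 → θ * p ≤ θ * r + θ ^ 2 * k) : p ≤ r := by
  have h1 : ∀ θ : ℝ, θ ∈ Ioc (0 : ℝ) 1 → p ≤ r + θ * k := fun θ hθ => by
    have := h θ hθ.1 hθ.2
    refine le_of_mul_le_mul_left ?_ hθ.1
    linarith
  have h2 : Tendsto (fun θ : ℝ => r + θ * k) (𝓝[>] 0) (𝓝 (r + 0 * k)) :=
    (Continuous.tendsto (by fun_prop) 0).mono_left nhdsWithin_le_nhds
  rw [zero_mul, add_zero] at h2
  exact ge_of_tendsto h2 (eventually_of_mem (Ioc_mem_nhdsGT one_pos) h1)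

/-- Minimizers of the objective yield fixed points of the dynamics. -/
theorem field_eq_zero_of_forall_objective_le {M N : ℕ} {Φ : Matrix (Fin M) (Fin N) ℝ}
    {y : EuclideanSpace ℝ (Fin M)} {lam : ℝ} (hlam : 0 ≤ lam) {a : EuclideanSpace ℝ (Fin N)}
    (ha : ∀ x, objective Φ y lam a ≤ objective Φ y lam x) :
    field Φ y lam (a + mulE Φ.transpose (y - mulE Φ a)) = 0 := by
  set r := mulE Φ.transpose (y - mulE Φ a) with hr
  have hout : output lam (a + r) = a := by
    ext n
    change softThreshold lam (a n + r n) = a n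
    refine softThreshold_add_eq hlam fun s => ?_
    -- Moving one coordinate a fraction `θ` towards `s` changes the `ℓ₁` part at most linearly in
    -- `θ`, by convexity; the quadratic remainder `θ²` disappears as `θ → 0`.
    set e : EuclideanSpace ℝ (Fin N) := EuclideanSpace.single n (s - a n) with he
    refine le_of_forall_mul_le_mul_add_sq (k := ‖mulE Φ e‖ ^ 2 / 2) fun θ h0 h1 => ?_
    have h2 := ha (a + θ • e)
    unfold objective at h2
    rw [mulE_add, mulE_smul, ← sub_sub, norm_sub_sq_real (y - mulE Φ a), inner_smul_right,
      real_inner_comm, ← inner_mulE_transpose, ← hr, norm_smul, Real.norm_eq_abs, abs_of_pos h0]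
      at h2
    have h3 : inner ℝ e r = r n * (s - a n) := by
      rw [he, EuclideanSpace.inner_single_left]
      simp [mul_comm]
    have h4 : ∑ k, |(a + θ • e) k| ≤ ∑ k, |a k| + θ * (|s| - |a n|) := by
      rw [← Finset.add_sum_erase _ _ (Finset.mem_univ n),
        ← Finset.add_sum_erase _ (fun k => |a k|) (Finset.mem_univ n)]
      have h5 : ∑ k ∈ Finset.univ.erase n, |(a + θ • e) k| = ∑ k ∈ Finset.univ.erase n, |a k| :=
        Finset.sum_congr rfl fun k hk => by simp [he, Finset.ne_of_mem_erase hk]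
      have h6 : (a + θ • e) n = (1 - θ) * a n + θ * s := by
        simp [he]; ring
      rw [h5, h6]
      have h7 := abs_add_le ((1 - θ) * a n) (θ * s)
      rw [abs_mul, abs_mul, abs_of_pos h0, abs_of_nonneg (sub_nonneg.2 h1)] at h7
      linarith
    rw [h3] at h2
    have h8 := mul_le_mul_of_nonneg_left h4 hlam
    nlinarith
  rw [field_eq_zero_iff, hout, ← hr, add_sub_cancel_left]

/-! ### The Lyapunov function and its dissipation -/

/-- The Bregman divergence summed over all coordinates, a Lyapunov function of the dynamics. -/
noncomputable def divergence {N : ℕ} (lam : ℝ) (v w : EuclideanSpace ℝ (Fin N)) : ℝ :=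
  ∑ n, bregman lam (v n) (w n)

/-- The rate at which `divergence` is dissipated. -/
noncomputable def dissipation {M N : ℕ} (Φ : Matrix (Fin M) (Fin N) ℝ) (lam : ℝ)
    (v w : EuclideanSpace ℝ (Fin N)) : ℝ :=
  ‖mulE Φ (output lam v - output lam w)‖ ^ 2 +
    inner ℝ (output lam v - output lam w) ((v - w) - (output lam v - output lam w))

theorem half_norm_sq_le_divergence {N : ℕ} {lam : ℝ} (hlam : 0 ≤ lam)
    (v w : EuclideanSpace ℝ (Fin N)) :
    ‖output lam v - output lam w‖ ^ 2 / 2 ≤ divergence lam v w := by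
  rw [norm_sq_eq_sum, Finset.sum_div]
  exact Finset.sum_le_sum fun n _ => half_sq_le_bregman hlam (v n) (w n)

theorem divergence_nonneg {N : ℕ} {lam : ℝ} (hlam : 0 ≤ lam)
    (v w : EuclideanSpace ℝ (Fin N)) : 0 ≤ divergence lam v w :=
  le_trans (by positivity) (half_norm_sq_le_divergence hlam v w)

theorem continuous_divergence {N : ℕ} {lam : ℝ} (hlam : 0 ≤ lam)
    (w : EuclideanSpace ℝ (Fin N)) : Continuous fun v => divergence lam v w := by
  have := continuous_softThreshold hlam
  unfold divergence bregman
  fun_prop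

theorem divergence_eq_zero {N : ℕ} {lam : ℝ} (hlam : 0 ≤ lam)
    {v w : EuclideanSpace ℝ (Fin N)} (h : output lam v = output lam w) :
    divergence lam v w = 0 :=
  Finset.sum_eq_zero fun n _ => bregman_eq_zero hlam (by rw [← output_apply, h, output_apply])

theorem inner_residual_term_nonneg {N : ℕ} {lam : ℝ} (hlam : 0 ≤ lam)
    (v w : EuclideanSpace ℝ (Fin N)) (n : Fin N) :
    0 ≤ (output lam v - output lam w) n * ((v - w) - (output lam v - output lam w)) n :=
  softThreshold_mul_residual_nonneg hlam (v n) (w n)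

theorem dissipation_nonneg {M N : ℕ} (Φ : Matrix (Fin M) (Fin N) ℝ) {lam : ℝ} (hlam : 0 ≤ lam)
    (v w : EuclideanSpace ℝ (Fin N)) : 0 ≤ dissipation Φ lam v w := by
  refine add_nonneg (sq_nonneg _) ?_
  rw [inner_eq_sum]
  exact Finset.sum_nonneg fun n _ => inner_residual_term_nonneg hlam v w n

theorem continuous_dissipation {M N : ℕ} (Φ : Matrix (Fin M) (Fin N) ℝ) {lam : ℝ}
    (hlam : 0 ≤ lam) (w : EuclideanSpace ℝ (Fin N)) :
    Continuous fun v => dissipation Φ lam v w := by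
  have h1 := continuous_output (N := N) hlam
  have h2 := continuous_mulE Φ
  unfold dissipation
  fun_prop

theorem field_eq_of_fixed {M N : ℕ} {Φ : Matrix (Fin M) (Fin N) ℝ}
    {y : EuclideanSpace ℝ (Fin M)} {lam : ℝ} {w : EuclideanSpace ℝ (Fin N)}
    (hw : field Φ y lam w = 0) (v : EuclideanSpace ℝ (Fin N)) :
    field Φ y lam v = -(v - w) + ((output lam v - output lam w) -
      mulE Φ.transpose (mulE Φ (output lam v - output lam w))) := by
  rw [← sub_zero (field Φ y lam v), ← hw, field_eq, field_eq]
  simp only [mulE_sub]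
  abel

theorem inner_output_sub_field {M N : ℕ} {Φ : Matrix (Fin M) (Fin N) ℝ}
    {y : EuclideanSpace ℝ (Fin M)} {lam : ℝ} {w : EuclideanSpace ℝ (Fin N)}
    (hw : field Φ y lam w = 0) (v : EuclideanSpace ℝ (Fin N)) :
    inner ℝ (output lam v - output lam w) (field Φ y lam v) = -dissipation Φ lam v w := by
  rw [field_eq_of_fixed hw, inner_add_right, inner_sub_right, inner_neg_right,
    inner_mulE_transpose, dissipation, inner_sub_right _ (v - w),
    real_inner_self_eq_norm_sq (mulE Φ _)]
  ring

theorem hasDerivWithinAt_divergence {N : ℕ} {lam : ℝ} (hlam : 0 ≤ lam)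
    {u : ℝ → EuclideanSpace ℝ (Fin N)} {u' : EuclideanSpace ℝ (Fin N)} {D : Set ℝ} {t : ℝ}
    (h : HasDerivWithinAt u u' D t) (w : EuclideanSpace ℝ (Fin N)) :
    HasDerivWithinAt (fun x => divergence lam (u x) w)
      (inner ℝ (output lam (u t) - output lam w) u') D t := by
  rw [inner_eq_sum]
  exact HasDerivWithinAt.fun_sum fun n _ =>
    HasDerivAt.comp_hasDerivWithinAt (h₂ := fun x => bregman lam x (w n)) t
      (hasDerivAt_bregman hlam (u t n) (w n)) (HasDerivWithinAt.apply_euclidean h n)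

theorem IsTrajectory.divergence_le {M N : ℕ} {Φ : Matrix (Fin M) (Fin N) ℝ}
    {y : EuclideanSpace ℝ (Fin M)} {lam τ : ℝ} {u : ℝ → EuclideanSpace ℝ (Fin N)}
    (hu : IsTrajectory Φ y lam τ u) (hlam : 0 ≤ lam) (hτ : 0 < τ)
    {w : EuclideanSpace ℝ (Fin N)} (hw : field Φ y lam w = 0) {s t m : ℝ} (hs : 0 ≤ s)
    (hst : s ≤ t) (hm : ∀ x, s ≤ x → m ≤ dissipation Φ lam (u x) w) :
    divergence lam (u t) w ≤ divergence lam (u s) w - m / τ * (t - s) := by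
  refine le_sub_mul_of_right_deriv_le hst (f := fun x => divergence lam (u x) w)
    ((continuous_divergence hlam w).comp_continuousOn
      (hu.continuousOn.mono (Ici_subset_Ici.2 hs)))
    (fun x hx => hasDerivWithinAt_divergence hlam (hu.hasDerivWithinAt hτ (hs.trans hx)) w)
    fun x hx => ?_
  rw [inner_smul_right, inner_output_sub_field hw, div_eq_inv_mul, mul_neg]
  exact neg_le_neg (mul_le_mul_of_nonneg_left (hm x hx) (inv_pos.2 hτ).le)

theorem IsTrajectory.divergence_antitone {M N : ℕ} {Φ : Matrix (Fin M) (Fin N) ℝ}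
    {y : EuclideanSpace ℝ (Fin M)} {lam τ : ℝ} {u : ℝ → EuclideanSpace ℝ (Fin N)}
    (hu : IsTrajectory Φ y lam τ u) (hlam : 0 ≤ lam) (hτ : 0 < τ)
    {w : EuclideanSpace ℝ (Fin N)} (hw : field Φ y lam w = 0) {s t : ℝ} (hs : 0 ≤ s)
    (hst : s ≤ t) : divergence lam (u t) w ≤ divergence lam (u s) w := by
  simpa using hu.divergence_le hlam hτ hw hs hst (m := 0) fun x _ => dissipation_nonneg Φ hlam _ _

/-- The closure of a bounded orbit contains a state at which nothing is dissipated. -/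
theorem IsTrajectory.exists_dissipation_eq_zero {M N : ℕ} {Φ : Matrix (Fin M) (Fin N) ℝ}
    {y : EuclideanSpace ℝ (Fin M)} {lam τ : ℝ} {u : ℝ → EuclideanSpace ℝ (Fin N)}
    (hu : IsTrajectory Φ y lam τ u) (hlam : 0 ≤ lam) (hτ : 0 < τ)
    (hb : Bornology.IsBounded (u '' Ici 0))
    {w : EuclideanSpace ℝ (Fin N)} (hw : field Φ y lam w = 0) :
    ∃ v ∈ closure (u '' Ici 0), dissipation Φ lam v w = 0 := by
  have hne : (closure (u '' Ici (0 : ℝ))).Nonempty :=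
    ⟨u 0, subset_closure (mem_image_of_mem u self_mem_Ici)⟩
  obtain ⟨v, hv, hmin⟩ := hb.isCompact_closure.exists_isMinOn hne
    (continuous_dissipation Φ hlam w).continuousOn
  refine ⟨v, hv, le_antisymm (not_lt.1 fun hpos => ?_) (dissipation_nonneg Φ hlam v w)⟩
  set m := dissipation Φ lam v w
  set d := divergence lam (u 0) w
  have hd : 0 ≤ d := divergence_nonneg hlam _ _
  -- Dissipation at least `m` up to this time would bring the divergence down to `-1`.
  have h := hu.divergence_le hlam hτ hw (s := 0) (t := (d + 1) * τ / m) le_rfl (by positivity)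
    (m := m) fun x hx => hmin (subset_closure (mem_image_of_mem u hx))
  have h1 : m / τ * ((d + 1) * τ / m - 0) = d + 1 := by field_simp; ring
  have := divergence_nonneg hlam (u ((d + 1) * τ / m)) w
  linarith

/-- Wherever nothing is dissipated, the output is that of a fixed point. -/
theorem exists_fixed_of_dissipation_eq_zero {M N : ℕ} {Φ : Matrix (Fin M) (Fin N) ℝ}
    {y : EuclideanSpace ℝ (Fin M)} {lam : ℝ} (hlam : 0 ≤ lam)
    {v w : EuclideanSpace ℝ (Fin N)} (hw : field Φ y lam w = 0)
    (h : dissipation Φ lam v w = 0) :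
    ∃ z, field Φ y lam z = 0 ∧ output lam z = output lam v := by
  have hnn : ∀ n ∈ Finset.univ, 0 ≤ (output lam v - output lam w) n *
      ((v - w) - (output lam v - output lam w)) n :=
    fun n _ => inner_residual_term_nonneg hlam v w n
  unfold dissipation at h
  rw [inner_eq_sum] at h
  have hsum := Finset.sum_nonneg hnn
  have h1 : mulE Φ (output lam v - output lam w) = 0 := by
    have : ‖mulE Φ (output lam v - output lam w)‖ ^ 2 = 0 := by
      linarith [sq_nonneg ‖mulE Φ (output lam v - output lam w)‖]
    simpa using this
  have h2 : ∑ n, (output lam v - output lam w) n *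
      ((v - w) - (output lam v - output lam w)) n = 0 := by
    linarith [sq_nonneg ‖mulE Φ (output lam v - output lam w)‖]
  rw [Finset.sum_eq_zero_iff_of_nonneg hnn] at h2
  -- The residual `w - T_λ(w)` depends only on `Φ T_λ(w) = Φ T_λ(v)`, so it is kept. In each
  -- coordinate either the outputs or the residuals of `v` and `w` agree.
  have hout : output lam (output lam v + (w - output lam w)) = output lam v := by
    ext n
    have h3 := h2 n (Finset.mem_univ n)
    simp only [output_apply, PiLp.add_apply, PiLp.sub_apply] at h3 ⊢
    rcases mul_eq_zero.1 h3 with h4 | h4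
    · rw [sub_eq_zero.1 h4, add_sub_cancel]
    · congr 1
      linarith
  refine ⟨_, ?_, hout⟩
  rw [mulE_sub, sub_eq_zero] at h1
  rw [field_eq_zero_iff, hout, h1, ← field_eq_zero_iff.1 hw, add_sub_cancel_left]

/-! ### From outputs to states, and the exponential rate -/

/-- Exponential bounds for the error of the output carry over to the error of the state. -/
theorem IsTrajectory.norm_sub_le {M N : ℕ} {Φ : Matrix (Fin M) (Fin N) ℝ}
    {y : EuclideanSpace ℝ (Fin M)} {lam τ : ℝ} {u : ℝ → EuclideanSpace ℝ (Fin N)}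
    (hu : IsTrajectory Φ y lam τ u) (hτ : 0 < τ) {w : EuclideanSpace ℝ (Fin N)}
    (hw : field Φ y lam w = 0) {C : ℝ}
    (hC : ∀ x, ‖mulE (Φ.transpose * Φ - 1) x‖ ≤ C * ‖x‖) (hC0 : 0 ≤ C) {β η s : ℝ}
    (hβ : β < 1) (hη : 0 ≤ η) (hs : 0 ≤ s)
    (h : ∀ t, s ≤ t → ‖output lam (u t) - output lam w‖ ≤ η * Real.exp (-(β * t / τ)))
    {t : ℝ} (ht : s ≤ t) :
    ‖u t - w‖ ≤ Real.exp (-((t - s) / τ)) * ‖u s - w‖ +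
      C * η / (1 - β) * Real.exp (-(β * t / τ)) := by
  refine norm_le_of_relaxation (w := fun t => u t - w)
    (g := fun t => -mulE (Φ.transpose * Φ - 1) (output lam (u t) - output lam w))
    hτ hβ (by positivity) ((hu.continuousOn.mono (Ici_subset_Ici.2 hs)).sub continuousOn_const)
    (fun t ht => (hu.hasDerivWithinAt hτ (hs.trans ht)).sub_const w) (fun t _ => ?_)
    (fun t ht => ?_) ht
  · rw [smul_inv_smul₀ hτ.ne', field_eq_of_fixed hw, mulE_gram_sub_one]
    abel
  · rw [norm_neg, mul_assoc]
    exact (hC _).trans (mul_le_mul_of_nonneg_left (h t ht) hC0)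

/-- If the outputs along a trajectory converge to the output of a fixed point, then the states
converge to this fixed point. -/
theorem IsTrajectory.tendsto_of_tendsto_output {M N : ℕ} {Φ : Matrix (Fin M) (Fin N) ℝ}
    {y : EuclideanSpace ℝ (Fin M)} {lam τ : ℝ} {u : ℝ → EuclideanSpace ℝ (Fin N)}
    (hu : IsTrajectory Φ y lam τ u) (hτ : 0 < τ) {w : EuclideanSpace ℝ (Fin N)}
    (hw : field Φ y lam w = 0)
    (h : Tendsto (fun t => output lam (u t)) atTop (𝓝 (output lam w))) :
    Tendsto u atTop (𝓝 w) := by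
  obtain ⟨C, hC0, hC⟩ := exists_norm_mulE_le (Φ.transpose * Φ - 1)
  rw [tendsto_iff_norm_sub_tendsto_zero] at h ⊢
  rw [Metric.tendsto_atTop'] at h ⊢
  intro e he
  -- With `β = 0` the forcing contributes `C * (e / 2 / C) = e / 2`, and the initial error decays
  -- below `e / 2`.
  obtain ⟨s, hs⟩ := h (e / 2 / C) (by positivity)
  set s' := max (s + 1) 0
  have hexp : Tendsto (fun t => Real.exp (-((t - s') / τ)) * ‖u s' - w‖) atTop
      (𝓝 (0 * ‖u s' - w‖)) := by
    refine Tendsto.mul_const _ (Real.tendsto_exp_neg_atTop_nhds_zero.comp ?_)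
    exact (tendsto_atTop_add_const_right _ (-s') tendsto_id).atTop_div_const hτ
  rw [zero_mul] at hexp
  obtain ⟨T, hT⟩ := eventually_atTop.1 (hexp.eventually_lt_const (half_pos he))
  refine ⟨max s' T, fun t ht => ?_⟩
  have h1 := hu.norm_sub_le hτ hw hC hC0.le (β := 0) (η := e / 2 / C) (s := s') zero_lt_one
    (by positivity) (le_max_right _ _) (fun x hx => ?_) ((le_max_left _ _).trans ht.le)
  · have h2 := hT t ((le_max_right _ _).trans ht.le)
    have h3 : C * (e / 2 / C) / (1 - 0) * Real.exp (-(0 * t / τ)) = e / 2 := by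
      simp only [sub_zero, div_one, zero_mul, zero_div, neg_zero, Real.exp_zero, mul_one]
      field_simp
    rw [Real.dist_eq, sub_zero, abs_norm]
    linarith
  · have h4 := hs x (lt_of_lt_of_le (lt_add_one s) ((le_max_left _ _).trans hx))
    rw [Real.dist_eq, sub_zero, abs_norm] at h4
    simpa using h4.le

/-- A trajectory that converges to a fixed point does so exponentially fast, if the restricted
isometry property covers all coordinates where the fixed point reaches the threshold. -/
theorem IsTrajectory.exists_exp_bound {M N k : ℕ} {Φ : Matrix (Fin M) (Fin N) ℝ}
    {y : EuclideanSpace ℝ (Fin M)} {lam τ δ : ℝ} {u : ℝ → EuclideanSpace ℝ (Fin N)}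
    (hu : IsTrajectory Φ y lam τ u) (hlam : 0 ≤ lam) (hτ : 0 < τ) (hRIP : RIP Φ k δ)
    {w : EuclideanSpace ℝ (Fin N)} (hw : field Φ y lam w = 0) (hlim : Tendsto u atTop (𝓝 w))
    (hk : (Finset.univ.filter fun n => lam ≤ |w n|).card ≤ k) :
    ∃ K : ℝ, 0 < K ∧ ∀ t : ℝ, 0 ≤ t → ‖u t - w‖ ≤ K * Real.exp (-((1 - δ) * t / τ)) := by
  -- Coordinates with `|w n| = λ` must be included, as they may switch on and off forever; outside
  -- `G` both outputs eventually vanish.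
  set G := Finset.univ.filter fun n => lam ≤ |w n| with hG
  have hδ := hRIP.1
  have hδ1 : 0 < 1 - δ := sub_pos.2 hRIP.2.1
  have hev : ∀ᶠ t in atTop, ∀ n, n ∉ G → |u t n| < lam := by
    refine eventually_all.2 fun n => eventually_imp_distrib_left.2 fun hn => ?_
    have hn' : |w n| < lam := not_le.1 fun h => hn (by simpa [hG] using h)
    exact (((PiLp.continuous_apply 2 (fun _ : Fin N => ℝ) n).tendsto w).comp
      hlim).abs.eventually_lt_const hn'
  obtain ⟨T, hT⟩ := eventually_atTop.1 hev
  set s := max T 0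
  have hs0 : 0 ≤ s := le_max_right _ _
  have hsupp : ∀ t, s ≤ t → ∀ n, n ∉ G → (output lam (u t) - output lam w) n = 0 := by
    intro t ht n hn
    have hn' : |w n| ≤ lam := le_of_lt (not_le.1 fun h => hn (by simpa [hG] using h))
    rw [PiLp.sub_apply, output_apply, output_apply, softThreshold_of_abs_le hn',
      softThreshold_of_abs_le (hT t ((le_max_left _ _).trans ht) n hn).le, sub_zero]
  have hle : ∀ t, s ≤ t →
      ‖output lam (u t) - output lam w‖ ^ 2 ≤ ‖restrict G (u t - w)‖ ^ 2 := by
    intro t ht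
    rw [norm_sq_restrict, norm_sq_eq_sum, ← Finset.sum_subset (Finset.subset_univ G)
      fun n _ hn => by rw [hsupp t ht n hn]; simp]
    exact Finset.sum_le_sum fun n _ => sq_le_sq.2 (abs_softThreshold_sub_le hlam (u t n) (w n))
  have hinner : ∀ t, s ≤ t → inner ℝ (restrict G (u t - w)) (field Φ y lam (u t)) ≤
      -((1 - δ) * ‖restrict G (u t - w)‖ ^ 2) := by
    intro t ht
    have hB := hRIP.inner_sub_inner_le hk (x := restrict G (u t - w))
      (fun n hn => by simp [restrict_apply, hn]) (hsupp t ht)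
    have hself : inner ℝ (restrict G (u t - w)) (u t - w) = ‖restrict G (u t - w)‖ ^ 2 := by
      rw [inner_restrict, norm_sq_restrict]
      exact Finset.sum_congr rfl fun n _ => by ring
    rw [field_eq_of_fixed hw, inner_add_right, inner_neg_right, hself, inner_sub_right,
      inner_mulE_transpose]
    nlinarith [hle t ht]
  set ψ : ℝ → ℝ := fun t => ‖restrict G (u t - w)‖ ^ 2 * Real.exp (2 * (1 - δ) / τ * t) with hψ
  have hψle : ∀ t, s ≤ t → ψ t ≤ ψ s := by
    intro t ht
    have hc : ContinuousOn ψ (Ici s) := by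
      refine ContinuousOn.mul ((((continuous_restrict G).comp_continuousOn
        ((hu.continuousOn.mono (Ici_subset_Ici.2 hs0)).sub continuousOn_const)).norm).pow 2) ?_
      exact Continuous.continuousOn (by fun_prop)
    have hd : ∀ x, s ≤ x → HasDerivWithinAt ψ
        (2 * inner ℝ (restrict G (u x - w)) (τ⁻¹ • field Φ y lam (u x)) *
          Real.exp (2 * (1 - δ) / τ * x) + ‖restrict G (u x - w)‖ ^ 2 *
          (Real.exp (2 * (1 - δ) / τ * x) * (2 * (1 - δ) / τ))) (Ici x) x := fun x hx => by
      have he : HasDerivAt (fun z => Real.exp (2 * (1 - δ) / τ * z))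
          (Real.exp (2 * (1 - δ) / τ * x) * (2 * (1 - δ) / τ)) x := by
        simpa using ((hasDerivAt_id x).const_mul (2 * (1 - δ) / τ)).exp
      exact (hasDerivWithinAt_norm_sq_restrict
        ((hu.hasDerivWithinAt hτ (hs0.trans hx)).sub_const w) G).mul he.hasDerivWithinAt
    have := le_sub_mul_of_right_deriv_le ht hc hd (m := 0) fun x hx => ?_
    · simpa using this
    · rw [inner_smul_right]
      have h1 := mul_le_mul_of_nonneg_left (hinner x hx)
        (by positivity : 0 ≤ 2 * Real.exp (2 * (1 - δ) / τ * x) * τ⁻¹)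
      rw [div_eq_mul_inv] at h1 ⊢
      linarith
  set K₁ := Real.sqrt (ψ s)
  have hψ0 : 0 ≤ ψ s := by positivity
  have hout : ∀ t, s ≤ t →
      ‖output lam (u t) - output lam w‖ ≤ K₁ * Real.exp (-((1 - δ) * t / τ)) := by
    intro t ht
    refine le_of_sq_le_sq ((hle t ht).trans ?_) (by positivity)
    rw [mul_pow, Real.sq_sqrt hψ0, ← Real.exp_nat_mul]
    refine le_trans (le_of_eq ?_) (mul_le_mul_of_nonneg_right (hψle t ht) (Real.exp_nonneg _))
    rw [hψ, mul_assoc, ← Real.exp_add]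
    rw [show 2 * (1 - δ) / τ * t + ((2 : ℕ) : ℝ) * -((1 - δ) * t / τ) = 0 by push_cast; ring,
      Real.exp_zero, mul_one]
  obtain ⟨C, hC0, hC⟩ := exists_norm_mulE_le (Φ.transpose * Φ - 1)
  obtain ⟨R, hR⟩ := isCompact_Icc.exists_bound_of_continuousOn (s := Icc 0 s)
    ((hu.continuousOn.mono Icc_subset_Ici_self).sub (continuousOn_const (c := w)))
  have hR0 : 0 ≤ R := (norm_nonneg _).trans (hR 0 ⟨le_rfl, hs0⟩)
  -- The terms cover the times before `s`, the error at `s`, the forcing (with `1 - β = δ`), and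
  -- positivity of `K`.
  refine ⟨R * Real.exp ((1 - δ) * s / τ) + Real.exp (s / τ) * ‖u s - w‖ + C * K₁ / δ + 1,
    by positivity, fun t ht => ?_⟩
  set X := Real.exp (-((1 - δ) * t / τ)) with hX
  have hX0 : 0 < X := Real.exp_pos _
  have hA : 0 ≤ Real.exp (s / τ) * ‖u s - w‖ * X := by positivity
  have hB : 0 ≤ C * K₁ / δ * X := by positivity
  have hD : 0 ≤ R * Real.exp ((1 - δ) * s / τ) * X := by positivity
  rcases le_total t s with hts | hst
  · have h1 : 1 ≤ Real.exp ((1 - δ) * s / τ) * X := by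
      rw [hX, ← Real.exp_add, Real.one_le_exp_iff, ← sub_eq_add_neg, ← sub_div, ← mul_sub]
      exact div_nonneg (mul_nonneg hδ1.le (sub_nonneg.2 hts)) hτ.le
    have h2 : ‖u t - w‖ ≤ R := hR t ⟨ht, hts⟩
    have h3 := mul_le_mul_of_nonneg_left h1 hR0
    linarith
  · have h1 := hu.norm_sub_le hτ hw hC hC0.le (by linarith : 1 - δ < 1) (Real.sqrt_nonneg _) hs0
      hout hst
    rw [sub_sub_cancel, ← hX] at h1
    have h2 : Real.exp (-((t - s) / τ)) ≤ Real.exp (s / τ) * X := by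
      rw [hX, ← Real.exp_add, Real.exp_le_exp, ← sub_eq_add_neg, ← sub_div, ← neg_div]
      refine div_le_div_of_nonneg_right ?_ hτ.le
      nlinarith
    have h3 := mul_le_mul_of_nonneg_right h2 (norm_nonneg (u s - w))
    linarith

/-- At a fixed point with at most `q` active nodes, fewer than `q` coordinates reach the
threshold. -/
theorem card_threshold_lt {M N q : ℕ} {Φ : Matrix (Fin M) (Fin N) ℝ}
    {y : EuclideanSpace ℝ (Fin M)} {lam : ℝ} (hlam : 0 ≤ lam)
    (hin : ∀ (v : EuclideanSpace ℝ (Fin N)) (s : Finset (Fin N)), s.card ≤ q →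
      activeSet lam v ⊆ s → lam ^ 2 * q ≤ ‖restrict s v‖ ^ 2 →
      inner ℝ (restrict s v) (field Φ y lam v) < 0)
    {w : EuclideanSpace ℝ (Fin N)} (hw : field Φ y lam w = 0)
    (hq : (activeSet lam w).card ≤ q) :
    (Finset.univ.filter fun n => lam ≤ |w n|).card < q := by
  by_contra hc
  have hsub : activeSet lam w ⊆ Finset.univ.filter fun n => lam ≤ |w n| := fun n hn => by
    simpa using (mem_activeSet.1 hn).le
  -- A set of exactly `q` coordinates between the active and the threshold set has norm at least
  -- `λ√q`, so `hin` contradicts `field = 0`.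
  obtain ⟨s, h1, h2, h3⟩ := Finset.exists_subsuperset_card_eq hsub hq (not_lt.1 hc)
  refine (hin w s h3.le h1 ?_).ne (by rw [hw, inner_zero_right])
  have h4 : ∑ _n ∈ s, lam ^ 2 ≤ ∑ n ∈ s, w n ^ 2 := by
    refine Finset.sum_le_sum fun n hn => ?_
    rw [← sq_abs (w n)]
    exact pow_le_pow_left₀ hlam (Finset.mem_filter.1 (h2 hn)).2 2
  rw [Finset.sum_const, h3, nsmul_eq_mul] at h4
  rw [norm_sq_restrict]
  linarith

theorem activeSet_eq_of_output_eq {N : ℕ} {lam : ℝ} (hlam : 0 ≤ lam)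
    {v w : EuclideanSpace ℝ (Fin N)} (h : output lam v = output lam w) :
    activeSet lam v = activeSet lam w := by
  have key : ∀ x : EuclideanSpace ℝ (Fin N), ∀ n, n ∈ activeSet lam x ↔ output lam x n ≠ 0 := by
    intro x n
    rw [mem_activeSet, output_apply, lt_abs]
    rcases softThreshold_cases hlam (x n) with ⟨h1, h2⟩ | ⟨h1, h2⟩ | ⟨h1, h1', h2⟩ <;> rw [h2]
    · exact ⟨fun _ => by linarith, fun _ => Or.inl h1⟩
    · exact ⟨fun _ => by linarith, fun _ => Or.inr (by linarith)⟩
    · exact ⟨fun h => by rcases h with h | h <;> linarith, fun h => absurd rfl h⟩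
  ext n
  rw [key, key, h]

/-- A bounded trajectory converges to a fixed point, whose output is that of a state in the closure
of the orbit. -/
theorem IsTrajectory.exists_tendsto {M N : ℕ} {Φ : Matrix (Fin M) (Fin N) ℝ}
    {y : EuclideanSpace ℝ (Fin M)} {lam τ : ℝ} {u : ℝ → EuclideanSpace ℝ (Fin N)}
    (hu : IsTrajectory Φ y lam τ u) (hlam : 0 < lam) (hτ : 0 < τ)
    (hb : Bornology.IsBounded (u '' Ici 0)) :
    ∃ v ∈ closure (u '' Ici 0), ∃ w, field Φ y lam w = 0 ∧ output lam w = output lam v ∧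
      Tendsto u atTop (𝓝 w) := by
  obtain ⟨a, ha⟩ := exists_forall_objective_le Φ y hlam
  obtain ⟨v, hv, hdis⟩ := hu.exists_dissipation_eq_zero hlam.le hτ hb
    -- The fixed point of an arbitrary minimizer serves only to find `v`; the limit is the fixed
    -- point `w` adapted to `v`.
    (field_eq_zero_of_forall_objective_le hlam.le ha)
  obtain ⟨w, hw, hwv⟩ := exists_fixed_of_dissipation_eq_zero hlam.le
    (field_eq_zero_of_forall_objective_le hlam.le ha) hdis
  refine ⟨v, hv, w, hw, hwv, hu.tendsto_of_tendsto_output hτ hw ?_⟩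
  rw [tendsto_iff_norm_sub_tendsto_zero, Metric.tendsto_atTop]
  intro e he
  have hopen : IsOpen {x : EuclideanSpace ℝ (Fin N) | divergence lam x w < e ^ 2 / 2} :=
    isOpen_Iio.preimage (continuous_divergence hlam.le w)
  obtain ⟨_, hx, s, hs, rfl⟩ := mem_closure_iff.1 hv _ hopen (by
    change divergence lam v w < e ^ 2 / 2
    rw [divergence_eq_zero hlam.le hwv.symm]
    positivity)
  refine ⟨s, fun t ht => ?_⟩
  rw [Real.dist_eq, sub_zero, abs_norm]
  have h1 := hu.divergence_antitone hlam.le hτ hw hs ht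
  have h2 := half_norm_sq_le_divergence hlam.le (u t) w
  have h3 : divergence lam (u s) w < e ^ 2 / 2 := hx
  refine lt_of_pow_lt_pow_left₀ 2 he.le ?_
  linarith

/-- With zero data, the only trajectory starting at rest stays at rest. -/
theorem IsTrajectory.eq_zero {M N : ℕ} {Φ : Matrix (Fin M) (Fin N) ℝ} {lam τ : ℝ}
    {u : ℝ → EuclideanSpace ℝ (Fin N)} (hu : IsTrajectory Φ 0 lam τ u) (hlam : 0 ≤ lam)
    (hτ : 0 < τ) (hw : field Φ 0 lam (0 : EuclideanSpace ℝ (Fin N)) = 0) (h0 : u 0 = 0) {t : ℝ}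
    (ht : 0 ≤ t) : u t = 0 := by
  obtain ⟨C, hC0, hC⟩ := exists_norm_mulE_le (Φ.transpose * Φ - 1)
  have h := hu.norm_sub_le hτ hw hC hC0.le (β := 0) (η := 0) zero_lt_one le_rfl le_rfl
    (fun x hx => ?_) ht
  · simpa [h0] using h
  -- The divergence from `0` starts at zero and never increases, so the output stays zero and the
  -- forcing vanishes.
  · have h1 := hu.divergence_antitone hlam hτ hw le_rfl hx
    rw [h0, divergence_eq_zero hlam rfl] at h1
    have h2 := half_norm_sq_le_divergence hlam (u x) 0
    rw [zero_mul]
    refine le_of_sq_le_sq ?_ le_rfl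
    linarith

theorem field_zero {M N : ℕ} (Φ : Matrix (Fin M) (Fin N) ℝ) {lam : ℝ} (hlam : 0 ≤ lam) :
    field Φ 0 lam (0 : EuclideanSpace ℝ (Fin N)) = 0 := by
  have : output lam (0 : EuclideanSpace ℝ (Fin N)) = 0 := by
    ext n
    exact softThreshold_of_abs_le (by simpa using hlam)
  rw [field_eq_zero_iff, this, mulE_zero, sub_zero, sub_zero, mulE_zero]

end LCA

/-! ### Proof of the theorem -/

theorem theorem3 {M N : ℕ} (Φ : Matrix (Fin M) (Fin N) ℝ) (S q : ℕ) (δ : ℝ)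
    (hRIP : LCA.RIP Φ (S + q) δ) (hδ : δ < 1 / 3)
    (aDag : EuclideanSpace ℝ (Fin N)) (hS : LCA.l0 aDag = S)
    (ε y : EuclideanSpace ℝ (Fin M)) (hy : y = LCA.mulE Φ aDag + ε)
    (lam τ : ℝ) (hlam : 0 ≤ lam) (hτ : 0 < τ)
    (u : ℝ → EuclideanSpace ℝ (Fin N)) (hu : LCA.IsTrajectory Φ y lam τ u)
    (hu0 : ‖u 0‖ ≤ lam * Real.sqrt q)
    (hthr : (1 + δ) / (1 - 3 * δ) * (‖aDag‖ + Real.sqrt (1 - δ) * ‖ε‖) ≤ lam * Real.sqrt q) :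
    (∀ t : ℝ, 0 ≤ t → (LCA.activeSet lam (u t)).card ≤ q) ∧
    (∃ uStar : EuclideanSpace ℝ (Fin N),
      LCA.field Φ y lam uStar = 0 ∧
      IsMinOn (LCA.objective Φ y lam) Set.univ (LCA.output lam uStar) ∧
      ∃ K : ℝ, 0 < K ∧ ∀ t : ℝ, 0 ≤ t →
        ‖u t - uStar‖ ≤ K * Real.exp (-((1 - δ) * t / τ))) := by
  have hδ0 := hRIP.1
  -- If `λ√q = 0`, all data vanish. This case is separate because coercivity needs `λ > 0` and the
  -- counting of active nodes needs `q > 0`.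
  rcases (by positivity : 0 ≤ lam * Real.sqrt q).eq_or_lt with hc | hc
  · rw [← hc] at hthr hu0
    have hcoef : 0 < (1 + δ) / (1 - 3 * δ) := div_pos (by linarith) (by linarith)
    have hsq : 0 < Real.sqrt (1 - δ) := Real.sqrt_pos.2 (by linarith)
    have hsum : ‖aDag‖ + Real.sqrt (1 - δ) * ‖ε‖ ≤ 0 :=
      not_lt.1 fun h => (mul_pos hcoef h).not_ge hthr
    have hε0 : 0 ≤ Real.sqrt (1 - δ) * ‖ε‖ := by positivity
    have ha : aDag = 0 := norm_le_zero_iff.1 (by linarith)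
    have hε : ε = 0 := by
      have : Real.sqrt (1 - δ) * ‖ε‖ = 0 := by linarith [norm_nonneg aDag]
      simpa [hsq.ne'] using this
    have hy0 : y = 0 := by rw [hy, ha, hε, LCA.mulE_zero, add_zero]
    rw [hy0] at hu ⊢
    have hw := LCA.field_zero Φ hlam (N := N)
    have hu' : ∀ t, 0 ≤ t → u t = 0 := fun t ht =>
      hu.eq_zero hlam hτ hw (norm_le_zero_iff.1 hu0) ht
    refine ⟨fun t ht => ?_, 0, hw, LCA.isMinOn_output hlam hw, 1, one_pos, fun t ht => ?_⟩
    · have : LCA.activeSet lam (u t) = ∅ := by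
        ext n
        simpa [LCA.mem_activeSet, hu' t ht] using hlam
      simp [this]
    · rw [hu' t ht, sub_zero, norm_zero]
      positivity
  · have hq : 0 < q := Nat.pos_of_ne_zero fun h => by simp [h] at hc
    have hlam' : 0 < lam := hlam.lt_of_ne fun h => by simp [← h] at hc
    have hc2 : (lam * Real.sqrt q) ^ 2 = lam ^ 2 * q := by
      rw [mul_pow, Real.sq_sqrt (Nat.cast_nonneg q)]
    have hbound := LCA.threshold_bound hδ0 hδ (norm_nonneg aDag) (norm_nonneg ε) hc hthr
    have hin : ∀ (v : EuclideanSpace ℝ (Fin N)) (s : Finset (Fin N)), s.card ≤ q →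
        LCA.activeSet lam v ⊆ s → lam ^ 2 * q ≤ ‖LCA.restrict s v‖ ^ 2 →
        inner ℝ (LCA.restrict s v) (LCA.field Φ y lam v) < 0 := by
      intro v s hs hsub hv
      rw [← hc2] at hv
      have h1 := LCA.inner_restrict_field_le hRIP hS ε hlam hs hsub
      rw [← hy] at h1
      have h2 : lam * Real.sqrt q ≤ ‖LCA.restrict s v‖ := le_of_sq_le_sq hv (norm_nonneg _)
      have h3 : (1 + δ) * ‖aDag‖ + Real.sqrt (1 + δ) * ‖ε‖ <
          (1 - δ) * ‖LCA.restrict s v‖ :=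
        hbound.trans_le (mul_le_mul_of_nonneg_left h2 (by linarith))
      have h4 := mul_lt_mul_of_pos_right h3 (hc.trans_le h2)
      linarith
    have hinv : ∀ t, 0 ≤ t → ∀ s : Finset (Fin N), s.card ≤ q →
        ‖LCA.restrict s (u t)‖ ^ 2 ≤ lam ^ 2 * q := fun t ht s hs =>
      LCA.norm_sq_restrict_le_of_inward hq hlam hτ hu
        (hc2 ▸ pow_le_pow_left₀ (norm_nonneg _) hu0 2) hin ht s hs
    -- The bounds pass to the closure because the limit `w` shares its output, hence its active set,
    -- with a state there.
    have hclosure : ∀ v ∈ closure (u '' Set.Ici 0), ∀ s : Finset (Fin N), s.card ≤ q →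
        ‖LCA.restrict s v‖ ^ 2 ≤ lam ^ 2 * q := by
      intro v hv s hs
      refine closure_minimal (t := {x | ‖LCA.restrict s x‖ ^ 2 ≤ lam ^ 2 * q}) ?_
        (isClosed_le ((LCA.continuous_restrict s).norm.pow 2) continuous_const) hv
      rintro _ ⟨t, ht, rfl⟩
      exact hinv t ht s hs
    have hb : Bornology.IsBounded (u '' Set.Ici 0) := by
      refine isBounded_iff_forall_norm_le.2 ⟨∑ _n : Fin N, lam * Real.sqrt q, ?_⟩
      rintro _ ⟨t, ht, rfl⟩
      refine (LCA.norm_le_sum_abs _).trans (Finset.sum_le_sum fun n _ => ?_)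
      have h1 := hinv t ht {n} (by rw [Finset.card_singleton]; exact hq)
      rw [LCA.norm_sq_restrict, Finset.sum_singleton, ← hc2] at h1
      exact abs_le_of_sq_le_sq h1 hc.le
    refine ⟨fun t ht => (LCA.card_activeSet_lt hq hlam (hinv t ht)).le, ?_⟩
    obtain ⟨v, hv, w, hw, hwv, hlim⟩ := hu.exists_tendsto hlam' hτ hb
    have hcard : (LCA.activeSet lam w).card ≤ q := by
      rw [LCA.activeSet_eq_of_output_eq hlam hwv]
      exact (LCA.card_activeSet_lt hq hlam (hclosure v hv)).le
    exact ⟨w, hw, LCA.isMinOn_output hlam hw, hu.exists_exp_bound hlam hτ hRIP hw hlim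
      ((LCA.card_threshold_lt hlam hin hw hcard).le.trans (Nat.le_add_left _ _))⟩
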